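/- Let $G$ be a finite group. A set $\delta$ of proper subgroups of $G$ is called a covering of $G$ if $G$ is the set-theoretical union of the members of $\delta$ and no member of $\delta$ is contained in a different member of $\delta$. The group $G$ is called $(\ast\ast)$-coverable if there are proper subgroups $H, K$ of $G$ such that $\delta=\{H^g, K^g : g\in G\}$ is a covering of $G$, where $H^g=g^{-1}Hg$. Theorem. Let $n$ be a natural number. The symmetric group $S_n$ is $(\ast\ast)$-coverable if and only if $3\le n\le 6$. -/

import Mathlib

/-- A set `δ` of subgroups of `G` is a covering of `G` if its members are proper subgroups, their
set-theoretical union is `G`, and there are no inclusions between distinct members. -/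
structure IsCovering {G : Type*} [Group G] (δ : Set (Subgroup G)) : Prop where
  proper : ∀ L ∈ δ, L < ⊤
  union_eq : (⋃ L ∈ δ, (L : Set G)) = Set.univ
  no_inclusions : ∀ L ∈ δ, ∀ M ∈ δ, L ≠ M → ¬ L ≤ M

/-- The conjugate `H ^ g = g⁻¹ H g`. -/
def conjSubgroup {G : Type*} [Group G] (H : Subgroup G) (g : G) : Subgroup G :=
  H.map (MulAut.conj g⁻¹).toMonoidHom

/-- The set of subgroups `{H ^ g, K ^ g : g ∈ G}`. -/
def conjFamily {G : Type*} [Group G] (H K : Subgroup G) : Set (Subgroup G) :=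
  {L | ∃ g : G, L = conjSubgroup H g ∨ L = conjSubgroup K g}

/-- `G` is `(∗∗)`-coverable: there are proper subgroups `H`, `K` of `G` such that
`{H ^ g, K ^ g : g ∈ G}` is a covering of `G`. -/
def IsStarStarCoverable (G : Type*) [Group G] : Prop :=
  ∃ H K : Subgroup G, H < ⊤ ∧ K < ⊤ ∧ IsCovering (conjFamily H K)

/-! For n ≥ 7, suppose that the conjugates of two proper subgroups H and K cover S_n. Only
permutations with at most three cycles are tested; each such cycle type occurs in H or in K.
Jordan's theorem is the engine: a primitive group with a transposition is S_n, and one with a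
3-cycle contains A_n. Suitable types have a power of this kind.

Types also decide transitivity and primitivity. A set fixed by an intransitive group has a size that
is a partial sum of every type present; a block containing a fixed point is likewise a union of
cycles; and a type (k, m) with coprime k, m > 1 excludes blocks in a transitive group.

If H contained A_n, every odd type would lie in K and force K = S_n
(`ConjCovers.not_alternatingGroup_le`). Otherwise let H be the subgroup with an n-cycle;
distributing a few more types between H and K gives a contradiction (`ConjCovers.false_of_odd`,
`ConjCovers.false_of_even`). Only n = 8 and n = 10 escape this bookkeeping; there H is triply
transitive with a double transposition, and explicit words yield a transposition or a 3-cycle.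

For 3 ≤ n ≤ 6 explicit pairs are checked: A_3 and S_2; D_8 and S_3; AGL(1,5) and S_2 × S_3; S_2 wr
S_3 and S_5. For n ≤ 2 all proper subgroups are trivial. -/

open Equiv Equiv.Perm MulAction
open scoped Pointwise

set_option linter.unusedSectionVars false

/-! ### Cycle types with at most three cycles, fixed sets, and Jordan's theorem. -/

section CycleTriples

variable {α : Type*} [Fintype α] [DecidableEq α]

/-- `σ` permutes each of the sets `A`, `B`, `C` cyclically, and these sets partition the space.
Empty sets are allowed. -/
structure IsCycleTriple (σ : Perm α) (A B C : Finset α) : Prop where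
  disjAB : Disjoint A B
  disjAC : Disjoint A C
  disjBC : Disjoint B C
  cover : ∀ x, x ∈ A ∨ x ∈ B ∨ x ∈ C
  cycA : σ.IsCycleOn A
  cycB : σ.IsCycleOn B
  cycC : σ.IsCycleOn C

/-- The subgroup `H` contains a permutation whose cycle lengths (fixed points included) are the
nonzero ones among `a`, `b`, `c`. -/
def HasType (H : Subgroup (Perm α)) (a b c : ℕ) : Prop :=
  ∃ σ ∈ H, ∃ A B C : Finset α, A.card = a ∧ B.card = b ∧ C.card = c ∧ IsCycleTriple σ A B C

/-- Every permutation has a conjugate in `H` or in `K`. -/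
def ConjCovers {G : Type*} [Group G] (H K : Subgroup G) : Prop :=
  ∀ σ : G, ∃ g : G, g * σ * g⁻¹ ∈ H ∨ g * σ * g⁻¹ ∈ K

theorem ConjCovers.symm {G : Type*} [Group G] {H K : Subgroup G} (h : ConjCovers H K) :
    ConjCovers K H := fun σ => (h σ).imp fun _ => Or.symm

theorem sign_of_isCycleOn {f : Perm α} {s : Finset α} (hf : f.IsCycleOn s) (hs : f.support ⊆ s) :
    sign f = (-1) ^ (s.card - 1) := by
  rcases le_or_gt s.card 1 with h | h
  · have : f = 1 := by
      rw [← support_eq_empty_iff, ← Finset.card_eq_zero]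
      by_contra h0
      have h1 := f.card_support_ne_one
      have h2 := Finset.card_le_card hs
      omega
    rw [this, Nat.sub_eq_zero_of_le h]; simp
  · have hnt : (s : Set α).Nontrivial := by
      rw [Finset.nontrivial_coe]; exact Finset.one_lt_card_iff_nontrivial.1 h
    have hsup : f.support = s := hs.antisymm fun x hx => mem_support.2 (hf.apply_ne hnt hx)
    have hc : f.IsCycle := isCycle_iff_exists_isCycleOn.2
      ⟨s, hnt, hf, fun x hx => by
        rw [← hsup, Finset.mem_coe, mem_support]; exact hx⟩
    rw [hc.sign, hsup]
    obtain ⟨m, hm⟩ : ∃ m, s.card = m + 1 := ⟨s.card - 1, by omega⟩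
    rw [hm, pow_succ]; simp

theorem IsCycleOn.congr_on {f g : Perm α} {s : Finset α} (hf : f.IsCycleOn s)
    (h : ∀ x ∈ s, g x = f x) : g.IsCycleOn s := by
  refine ⟨hf.1.congr fun x hx => (h x hx).symm, fun x hx y hy => ?_⟩
  obtain ⟨n, -, hn⟩ := hf.exists_pow_eq hx hy
  refine ⟨n, ?_⟩
  rw [zpow_natCast, ← hn]
  have key : ∀ k : ℕ, (g ^ k) x = (f ^ k) x := by
    intro k
    induction k with
    | zero => rfl
    | succ k ih =>
      rw [pow_succ', pow_succ', Perm.mul_apply, Perm.mul_apply, ih]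
      refine h _ ?_
      exact (hf.1.perm_pow k).mapsTo hx
  exact key n

/-- Truncated subtraction makes an empty cycle contribute 0 to the sign exponent, as it should. -/
theorem exists_isCycleTriple {a b c : ℕ} (h : a + b + c = Fintype.card α) :
    ∃ (σ : Perm α) (A B C : Finset α), A.card = a ∧ B.card = b ∧ C.card = c ∧
      IsCycleTriple σ A B C ∧ sign σ = (-1) ^ ((a - 1) + (b - 1) + (c - 1)) := by
  obtain ⟨A, -, hA⟩ := Finset.exists_subset_card_eq (s := (Finset.univ : Finset α)) (n := a)
    (by rw [Finset.card_univ]; omega)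
  obtain ⟨B, hBA, hB⟩ := Finset.exists_subset_card_eq (s := Aᶜ) (n := b)
    (by rw [Finset.card_compl]; omega)
  have hAB : Disjoint A B := (Finset.disjoint_of_subset_left hBA disjoint_compl_left).symm
  have hC : ((A ∪ B)ᶜ).card = c := by
    rw [Finset.card_compl, Finset.card_union_of_disjoint hAB]; omega
  set C := (A ∪ B)ᶜ with hCdef
  have hAC : Disjoint A C := (disjoint_compl_right.mono_left Finset.subset_union_left)
  have hBC : Disjoint B C := (disjoint_compl_right.mono_left Finset.subset_union_right)
  obtain ⟨f, hf, hfs⟩ := A.exists_cycleOn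
  obtain ⟨g, hg, hgs⟩ := B.exists_cycleOn
  obtain ⟨k, hk, hks⟩ := C.exists_cycleOn
  have fixf : ∀ x, x ∉ A → f x = x := fun x hx => notMem_support.1 fun h => hx (hfs h)
  have fixg : ∀ x, x ∉ B → g x = x := fun x hx => notMem_support.1 fun h => hx (hgs h)
  have fixk : ∀ x, x ∉ C → k x = x := fun x hx => notMem_support.1 fun h => hx (hks h)
  refine ⟨f * g * k, A, B, C, hA, hB, hC, ⟨hAB, hAC, hBC, fun x => ?_, ?_, ?_, ?_⟩, ?_⟩
  · by_cases h1 : x ∈ A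
    · exact Or.inl h1
    by_cases h2 : x ∈ B
    · exact Or.inr (Or.inl h2)
    exact Or.inr (Or.inr (by simp [hCdef, h1, h2]))
  · refine IsCycleOn.congr_on hf fun x hx => ?_
    rw [Perm.mul_apply, Perm.mul_apply, fixk x (Finset.disjoint_left.1 hAC hx),
      fixg x (Finset.disjoint_left.1 hAB hx)]
  · refine IsCycleOn.congr_on hg fun x hx => ?_
    rw [Perm.mul_apply, Perm.mul_apply, fixk x (Finset.disjoint_left.1 hBC hx),
      fixf _ (Finset.disjoint_right.1 hAB (hg.1.mapsTo hx))]
  · refine IsCycleOn.congr_on hk fun x hx => ?_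
    have hx' : k x ∈ C := hk.1.mapsTo hx
    rw [Perm.mul_apply, Perm.mul_apply, fixg _ (Finset.disjoint_right.1 hBC hx'),
      fixf _ (Finset.disjoint_right.1 hAC hx')]
  · rw [Perm.sign_mul, Perm.sign_mul, sign_of_isCycleOn hf hfs, sign_of_isCycleOn hg hgs,
      sign_of_isCycleOn hk hks, hA, hB, hC, pow_add, pow_add]

theorem IsCycleTriple.conj {σ : Perm α} {A B C : Finset α} (h : IsCycleTriple σ A B C)
    (g : Perm α) : IsCycleTriple (g * σ * g⁻¹) (A.map g.toEmbedding) (B.map g.toEmbedding)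
      (C.map g.toEmbedding) where
  disjAB := (Finset.disjoint_map _).2 h.disjAB
  disjAC := (Finset.disjoint_map _).2 h.disjAC
  disjBC := (Finset.disjoint_map _).2 h.disjBC
  cover x := by
    have := h.cover (g⁻¹ x)
    simpa [Finset.mem_map_equiv] using this
  cycA := by simpa using h.cycA.conj (g := g)
  cycB := by simpa using h.cycB.conj (g := g)
  cycC := by simpa using h.cycC.conj (g := g)

theorem HasType.of_conj_mem {H : Subgroup (Perm α)} {σ g : Perm α} {A B C : Finset α}
    (h : IsCycleTriple σ A B C) (hg : g * σ * g⁻¹ ∈ H) : HasType H A.card B.card C.card :=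
  ⟨_, hg, _, _, _, Finset.card_map _, Finset.card_map _, Finset.card_map _, h.conj g⟩

theorem ConjCovers.hasType {H K : Subgroup (Perm α)} (hc : ConjCovers H K) {a b c : ℕ}
    (h : a + b + c = Fintype.card α) : HasType H a b c ∨ HasType K a b c := by
  obtain ⟨σ, A, B, C, rfl, rfl, rfl, hT, -⟩ := exists_isCycleTriple h
  obtain ⟨g, hg | hg⟩ := hc σ
  · exact Or.inl (.of_conj_mem hT hg)
  · exact Or.inr (.of_conj_mem hT hg)

/-- An odd permutation has no conjugate in `H`, so `K` must receive every odd type. -/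
theorem ConjCovers.hasType_of_le_alternating {H K : Subgroup (Perm α)} (hc : ConjCovers H K)
    (hH : H ≤ alternatingGroup α) {a b c : ℕ} (h : a + b + c = Fintype.card α)
    (hodd : Odd ((a - 1) + (b - 1) + (c - 1))) : HasType K a b c := by
  obtain ⟨σ, A, B, C, rfl, rfl, rfl, hT, hs⟩ := exists_isCycleTriple h
  obtain ⟨g, hg | hg⟩ := hc σ
  · have h1 := mem_alternatingGroup.1 (hH hg)
    rw [Perm.sign_mul, Perm.sign_mul, sign_inv, mul_right_comm, Int.units_mul_self, one_mul, hs,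
      hodd.neg_one_pow] at h1
    exact absurd h1 (by decide)
  · exact .of_conj_mem hT hg

theorem IsCycleOn.subset_or_disjoint {σ : Perm α} {A S : Finset α} (hA : σ.IsCycleOn A)
    (hS : ∀ x ∈ S, σ x ∈ S) : A ⊆ S ∨ Disjoint S A := by
  by_cases h : ∃ x ∈ S, x ∈ A
  · obtain ⟨x, hx, hxA⟩ := h
    refine Or.inl fun y hy => ?_
    obtain ⟨n, -, rfl⟩ := hA.exists_pow_eq hxA hy
    clear hy
    induction n with
    | zero => simpa using hx
    | succ n ih => rw [pow_succ', Perm.mul_apply]; exact hS _ ih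
  · push Not at h
    exact Or.inr (Finset.disjoint_left.2 h)

theorem IsCycleOn.card_inter {σ : Perm α} {A S : Finset α} (hA : σ.IsCycleOn A)
    (hS : ∀ x ∈ S, σ x ∈ S) : (S ∩ A).card = A.card ∨ (S ∩ A).card = 0 := by
  rcases IsCycleOn.subset_or_disjoint hA hS with h | h
  · left; rw [Finset.inter_eq_right.2 h]
  · right; rw [Finset.disjoint_iff_inter_eq_empty.1 h, Finset.card_empty]

theorem IsCycleTriple.card_eq {σ : Perm α} {A B C : Finset α} (h : IsCycleTriple σ A B C)
    (S : Finset α) : S.card = (S ∩ A).card + (S ∩ B).card + (S ∩ C).card := by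
  rw [← Finset.card_union_of_disjoint, ← Finset.card_union_of_disjoint]
  · congr 1
    ext x
    have := h.cover x
    simp only [Finset.mem_union, Finset.mem_inter]
    tauto
  · rw [Finset.disjoint_union_left]
    exact ⟨h.disjAC.mono Finset.inter_subset_right Finset.inter_subset_right,
      h.disjBC.mono Finset.inter_subset_right Finset.inter_subset_right⟩
  · exact h.disjAB.mono Finset.inter_subset_right Finset.inter_subset_right

theorem HasType.add_eq {H : Subgroup (Perm α)} {a b c : ℕ} (h : HasType H a b c) :
    a + b + c = Fintype.card α := by
  obtain ⟨σ, -, A, B, C, rfl, rfl, rfl, hT⟩ := h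
  rw [← Finset.card_univ, hT.card_eq Finset.univ]
  simp

/-- An intransitive group fixes a set whose size is a partial sum of each cycle type in it. -/
theorem exists_partial_sum_of_not_isPretransitive {H : Subgroup (Perm α)} [Nonempty α]
    (hH : ¬ IsPretransitive H α) : ∃ s, 0 < s ∧ s < Fintype.card α ∧
      ∀ a b c, HasType H a b c → ∃ x y z, (x = a ∨ x = 0) ∧ (y = b ∨ y = 0) ∧ (z = c ∨ z = 0) ∧
        s = x + y + z := by
  classical
  obtain ⟨x₀⟩ := ‹Nonempty α›
  have : ∃ x y : α, y ∉ orbit H x := by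
    by_contra hcon
    push Not at hcon
    exact hH ⟨fun x y => hcon x y⟩
  obtain ⟨x, y, hy⟩ := this
  refine ⟨(orbit H x).toFinset.card, ?_, ?_, ?_⟩
  · exact Finset.card_pos.2 ⟨x, by simp⟩
  · refine Finset.card_lt_univ_of_notMem (x := y) (by simpa using hy)
  · rintro a b c ⟨σ, hσ, A, B, C, rfl, rfl, rfl, hT⟩
    have hS : ∀ z ∈ (orbit H x).toFinset, σ z ∈ (orbit H x).toFinset := by
      intro z hz
      rw [Set.mem_toFinset] at hz ⊢
      exact mem_orbit_of_mem_orbit (⟨σ, hσ⟩ : H) hz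
    exact ⟨_, _, _, IsCycleOn.card_inter hT.cycA hS, IsCycleOn.card_inter hT.cycB hS,
      IsCycleOn.card_inter hT.cycC hS, hT.card_eq _⟩

theorem HasType.isPretransitive {H : Subgroup (Perm α)} {n : ℕ} (h : HasType H 0 0 n) :
    IsPretransitive H α := by
  rcases isEmpty_or_nonempty α with hα | hα
  · exact ⟨fun x => hα.elim x⟩
  by_contra hH
  obtain ⟨s, hs, hs', hsum⟩ := exists_partial_sum_of_not_isPretransitive hH
  obtain ⟨x, y, z, hx, hy, hz, he⟩ := hsum _ _ _ h
  have := h.add_eq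
  omega

/-- A power of a permutation with cycle lengths `a`, `b`, `c` moves exactly the first cycle, if its
exponent is a multiple of `b` and `c` but not of `a`. -/
theorem HasType.exists_support_card {H : Subgroup (Perm α)} {a b c : ℕ} (h : HasType H a b c)
    (m : ℕ) (ha : ¬ a ∣ m) (hb : b = 0 ∨ b ∣ m) (hc : c = 0 ∨ c ∣ m) :
    ∃ τ ∈ H, τ.support.card = a := by
  obtain ⟨σ, hσ, A, B, C, rfl, rfl, rfl, hT⟩ := h
  refine ⟨σ ^ m, H.pow_mem hσ _, ?_⟩
  congr 1
  ext x
  rw [mem_support, Ne]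
  rcases hT.cover x with hx | hx | hx
  · rw [hT.cycA.pow_apply_eq hx]; simp [ha, hx]
  · rw [hT.cycB.pow_apply_eq hx]
    simp [Finset.disjoint_right.1 hT.disjAB hx, hb.resolve_left (Finset.card_ne_zero_of_mem hx)]
  · rw [hT.cycC.pow_apply_eq hx]
    simp [Finset.disjoint_right.1 hT.disjAC hx, hc.resolve_left (Finset.card_ne_zero_of_mem hx)]

theorem HasType.exists_support_card_of_prime {H : Subgroup (Perm α)} {p b c : ℕ} (hp : p.Prime)
    (h : HasType H p b c) (hb : b = 0 ∨ ¬ p ∣ b) (hc : c = 0 ∨ ¬ p ∣ c) :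
    ∃ τ ∈ H, τ.support.card = p := by
  -- The exponent is bc, with empty cycles counted as 1; a factor 0 would make it divisible by p.
  refine h.exists_support_card ((if b = 0 then 1 else b) * (if c = 0 then 1 else c)) ?_ ?_ ?_
  · rw [hp.dvd_mul]
    have := hp.one_lt
    split_ifs <;> simp <;> grind
  · by_cases h : b = 0
    · exact Or.inl h
    · right; rw [if_neg h]; exact dvd_mul_right _ _
  · by_cases h : c = 0
    · exact Or.inl h
    · right; rw [if_neg h]; exact dvd_mul_left _ _

theorem HasType.eq_top {H : Subgroup (Perm α)} (hH : IsPreprimitive H α) {b c : ℕ}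
    (h : HasType H 2 b c) (hb : b = 0 ∨ ¬ 2 ∣ b) (hc : c = 0 ∨ ¬ 2 ∣ c) : H = ⊤ := by
  obtain ⟨τ, hτ, hcard⟩ := h.exists_support_card_of_prime Nat.prime_two hb hc
  exact subgroup_eq_top_of_isPreprimitive_of_isSwap_mem hH τ (card_support_eq_two.1 hcard) hτ

theorem HasType.alternatingGroup_le {H : Subgroup (Perm α)} (hH : IsPreprimitive H α) {b c : ℕ}
    (h : HasType H 3 b c) (hb : b = 0 ∨ ¬ 3 ∣ b) (hc : c = 0 ∨ ¬ 3 ∣ c) :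
    alternatingGroup α ≤ H := by
  obtain ⟨τ, hτ, hcard⟩ := h.exists_support_card_of_prime Nat.prime_three hb hc
  exact alternatingGroup_le_of_isPreprimitive_of_isThreeCycle_mem hH
    (card_support_eq_three_iff.1 hcard) hτ

end CycleTriples

/-! ### Block systems of imprimitive groups. -/

section Blocks

variable {α : Type*} [Fintype α] [DecidableEq α]

/-- A transitive imprimitive group has a system of blocks, given here as the map sending a point
to its block. -/
theorem exists_blocks {H : Subgroup (Perm α)} (ht : IsPretransitive H α)
    (hH : ¬ IsPreprimitive H α) : ∃ (d : ℕ) (β : α → Finset α), 1 < d ∧ d < Fintype.card α ∧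
      (∀ x, x ∈ β x) ∧ (∀ x, (β x).card = d) ∧ (∀ x y, y ∈ β x → β y = β x) ∧
      ∀ σ ∈ H, ∀ x, ∀ y ∈ β x, σ y ∈ β (σ x) := by
  classical
  have : ∃ B : Set α, IsBlock H B ∧ ¬ IsTrivialBlock B := by
    by_contra hcon
    push Not at hcon
    exact hH { isTrivialBlock_of_isBlock := fun {B} hB => hcon B hB }
  obtain ⟨B, hB, hBt⟩ := this
  simp only [IsTrivialBlock, not_or] at hBt
  obtain ⟨hB1, hB2⟩ := hBt
  have hne : B.Nonempty := (Set.not_subsingleton_iff.1 hB1).nonempty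
  obtain ⟨b, hb⟩ := hne
  -- `g x` carries `b` to `x`, so `g x • B` is the block of `x`.
  choose g hg using fun x => exists_smul_eq H b x
  have hmem : ∀ x, x ∈ g x • B := fun x => ⟨b, hb, hg x⟩
  have huniq : ∀ x (k l : H), x ∈ k • B → x ∈ l • B → k • B = l • B := by
    intro x k l hk hl
    exact (isBlock_iff_smul_eq_smul_or_disjoint.1 hB k l).resolve_right
      (Set.not_disjoint_iff.2 ⟨x, hk, hl⟩)
  refine ⟨B.toFinset.card, fun x => (g x • B).toFinset, ?_, ?_, ?_, ?_, ?_, ?_⟩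
  · rw [Finset.one_lt_card_iff_nontrivial]
    simpa [Finset.Nontrivial] using Set.not_subsingleton_iff.1 hB1
  · rw [Finset.card_lt_iff_ne_univ]
    simpa using hB2
  · intro x; rw [Set.mem_toFinset]; exact hmem x
  · intro x
    rw [Set.toFinset_card, Set.toFinset_card, ← Nat.card_eq_fintype_card,
      ← Nat.card_eq_fintype_card, Nat.card_coe_set_eq, Nat.card_coe_set_eq]
    exact Set.ncard_smul_set _ _
  · intro x y hy
    rw [Set.mem_toFinset] at hy
    rw [Set.toFinset_inj]
    exact huniq y _ _ (hmem y) hy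
  · intro σ hσ x y hy
    rw [Set.mem_toFinset] at hy ⊢
    have h1 : (⟨σ, hσ⟩ * g x : H) • B = g (σ x) • B :=
      huniq (σ x) _ _ (by rw [mul_smul]; exact Set.smul_mem_smul_set (hmem x)) (hmem _)
    rw [← h1, mul_smul]
    exact Set.smul_mem_smul_set hy

/-- A set which is a union of blocks of size `d` has size divisible by `d`. -/
theorem dvd_card_of_blocks {d : ℕ} {β : α → Finset α} (hmem : ∀ x, x ∈ β x)
    (hcard : ∀ x, (β x).card = d) (heq : ∀ x y, y ∈ β x → β y = β x) {S : Finset α}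
    (hS : ∀ x ∈ S, β x ⊆ S) : d ∣ S.card := by
  rw [Finset.card_eq_sum_card_image β S]
  refine Finset.dvd_sum fun T hT => ?_
  obtain ⟨x, hx, rfl⟩ := Finset.mem_image.1 hT
  rw [← hcard x]
  refine dvd_of_eq (congrArg _ ?_)
  ext y
  rw [Finset.mem_filter]
  exact ⟨fun hy => ⟨hS x hx hy, heq x y hy⟩, fun hy => hy.2 ▸ hmem y⟩

/-- If the block of some x in `B` meets `C`, then σ^|B| fixes x, preserves the block and, by
coprimality, is still cyclic on `C`; so the block contains `C`. By symmetry it contains `B`, hence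
everything. Otherwise `B` and `C` are unions of blocks, and `d` divides both lengths. -/
theorem HasType.not_coprime_of_blocks {H : Subgroup (Perm α)} {d : ℕ} {β : α → Finset α}
    (hd : 1 < d) (hd' : d < Fintype.card α) (hmem : ∀ x, x ∈ β x)
    (hcard : ∀ x, (β x).card = d) (heq : ∀ x y, y ∈ β x → β y = β x)
    (hβ : ∀ σ ∈ H, ∀ x, ∀ y ∈ β x, σ y ∈ β (σ x)) {k m : ℕ} (h : HasType H 0 k m)
    (hk : 1 < k) (hm : 1 < m) : ¬ k.Coprime m := by
  intro hco
  obtain ⟨σ, hσ, A, B, C, hA, rfl, rfl, hT⟩ := h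
  rw [Finset.card_eq_zero] at hA
  subst hA
  have key : ∀ B C : Finset α, IsCycleTriple σ ∅ B C → B.card.Coprime C.card → 1 < C.card →
      ∀ x ∈ B, ∀ y ∈ β x, y ∈ C → C ⊆ β x := by
    intro B C hT hco hC x hx y hy hyC
    have hfix : (σ ^ B.card) x = x := hT.cycB.pow_card_apply hx
    have hinv : ∀ z ∈ β x, (σ ^ B.card) z ∈ β x := fun z hz => by
      have := hβ _ (H.pow_mem hσ B.card) x z hz
      rwa [hfix] at this
    intro z hz
    obtain ⟨n, -, hn⟩ := hT.cycC.exists_pow_eq hyC hz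
    obtain ⟨j, hj⟩ : ∃ j, B.card * j ≡ n [MOD C.card] := by
      obtain ⟨j, -, hj⟩ := Nat.exists_mul_mod_eq_one_of_coprime hco hC
      refine ⟨j * n, ?_⟩
      have : B.card * j ≡ 1 [MOD C.card] := by
        rw [Nat.ModEq, hj, Nat.mod_eq_of_lt hC]
      simpa [mul_assoc] using this.mul_right n
    have h2 : (σ ^ (B.card * j)) y = z := by
      rw [← hn]; exact (hT.cycC.pow_apply_eq_pow_apply hyC).2 hj
    rw [← h2, pow_mul]
    clear hj h2
    induction j with
    | zero => simpa using hy
    | succ j ih => rw [pow_succ', Perm.mul_apply]; exact hinv _ ih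
  have hT' : IsCycleTriple σ ∅ C B := ⟨hT.disjAC, hT.disjAB, hT.disjBC.symm,
    fun x => by have := hT.cover x; tauto, hT.cycA, hT.cycC, hT.cycB⟩
  have hBC : ∀ x ∈ B, ∀ y ∈ β x, y ∉ C := by
    intro x hx y hy hyC
    have h1 := key B C hT hco hm x hx y hy hyC
    have h2 := key C B hT' hco.symm hk y hyC x (by rw [heq x y hy]; exact hmem x) hx
    rw [heq x y hy] at h2
    have h3 : β x = Finset.univ := Finset.eq_univ_of_forall fun z => by
      rcases hT.cover z with h | h | h
      · simp at h
      · exact h2 h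
      · exact h1 h
    have := hcard x
    rw [h3, Finset.card_univ] at this
    omega
  have d1 : d ∣ B.card := dvd_card_of_blocks hmem hcard heq fun x hx y hy => by
    rcases hT.cover y with h | h | h
    · simp at h
    · exact h
    · exact absurd h (hBC x hx y hy)
  have d2 : d ∣ C.card := dvd_card_of_blocks hmem hcard heq fun x hx y hy => by
    rcases hT.cover y with h | h | h
    · simp at h
    · refine absurd hx (hBC y h x ?_)
      rw [heq x y hy]; exact hmem x
    · exact h
  have := Nat.dvd_gcd d1 d2
  rw [hco] at this
  have := Nat.le_of_dvd one_pos this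
  omega

/-- A transitive imprimitive group: the block size is constrained by the cycle types in it which
have a fixed point, and there is no cycle type with two coprime lengths. -/
theorem exists_block_card_of_not_isPreprimitive {H : Subgroup (Perm α)}
    (ht : IsPretransitive H α) (hH : ¬ IsPreprimitive H α) :
    ∃ d, 1 < d ∧ d < Fintype.card α ∧ d ∣ Fintype.card α ∧
      (∀ b c, HasType H 1 b c → ∃ y z, (y = b ∨ y = 0) ∧ (z = c ∨ z = 0) ∧ d = 1 + y + z) ∧
      ∀ k m, HasType H 0 k m → 1 < k → 1 < m → ¬ k.Coprime m := by
  obtain ⟨d, β, hd, hd', hmem, hcard, heq, hβ⟩ := exists_blocks ht hH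
  refine ⟨d, hd, hd', ?_, ?_, fun k m h hk hm =>
    h.not_coprime_of_blocks hd hd' hmem hcard heq hβ hk hm⟩
  · rw [← Finset.card_univ]
    exact dvd_card_of_blocks hmem hcard heq fun x _ => Finset.subset_univ _
  · rintro b c ⟨σ, hσ, A, B, C, hA, rfl, rfl, hT⟩
    obtain ⟨x, rfl⟩ := Finset.card_eq_one.1 hA
    have hx : σ x = x := by simpa using hT.cycA
    have hS : ∀ y ∈ β x, σ y ∈ β x := fun y hy => by
      have := hβ σ hσ x y hy
      rwa [hx] at this
    refine ⟨_, _, IsCycleOn.card_inter hT.cycB hS, IsCycleOn.card_inter hT.cycC hS, ?_⟩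
    rw [← hcard x, hT.card_eq (β x), Finset.inter_singleton_of_mem (hmem x),
      Finset.card_singleton]

end Blocks

/-! ### Triple transitivity and double transpositions. -/

section ThreeTransitive

variable {α : Type*} [Fintype α] [DecidableEq α]

/-- A transitive group containing a cycle on all points but one, and a permutation `σ` fixing `x`
and `y` and cyclic on the other points, is `3`-transitive. -/
theorem exists_mem_map_triple {H : Subgroup (Perm α)} (ht : IsPretransitive H α) {m : ℕ}
    (h1 : HasType H 0 1 m) {σ : Perm α} (hσ : σ ∈ H) {x y : α} {C : Finset α}
    (hx : σ x = x) (hy : σ y = y) (hxy : x ≠ y)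
    (hC : σ.IsCycleOn C) (hcov : ∀ w, w ≠ x → w ≠ y → w ∈ C) {a b c z : α} (hab : a ≠ b)
    (hac : a ≠ c) (hbc : b ≠ c) (hz : z ∈ C) : ∃ h ∈ H, h a = x ∧ h b = y ∧ h c = z := by
  obtain ⟨τ, hτ, A, U, D, hA, hU, -, hT⟩ := h1
  rw [Finset.card_eq_zero] at hA
  subst hA
  obtain ⟨u, rfl⟩ := Finset.card_eq_one.1 hU
  have hu : τ u = u := by simpa using hT.cycB
  have hD : ∀ w, w ≠ u → w ∈ D := fun w hw => by
    have := hT.cover w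
    simpa [hw] using this
  -- Double transitivity: move p to the fixed point u of τ, then rotate the other points by τ.
  have toU : ∀ p q v : α, p ≠ q → v ≠ u → ∃ h ∈ H, h p = u ∧ h q = v := by
    intro p q v hpq hv
    obtain ⟨⟨g, hg⟩, hgp⟩ := exists_smul_eq H p u
    replace hgp : g p = u := hgp
    have hgq : g q ≠ u := fun h => hpq (g.injective (hgp.trans h.symm))
    obtain ⟨n, -, hn⟩ := hT.cycC.exists_pow_eq (hD _ hgq) (hD _ hv)
    refine ⟨τ ^ n * g, H.mul_mem (H.pow_mem hτ n) hg, ?_, hn⟩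
    rw [Perm.mul_apply, hgp]
    exact Perm.pow_apply_eq_self_of_apply_eq_self hu n
  obtain ⟨v, hv⟩ : ∃ v, v ≠ u := by
    by_cases h : x = u
    · exact ⟨y, fun h' => hxy (h.trans h'.symm)⟩
    · exact ⟨x, h⟩
  obtain ⟨g, hg, hga, hgb⟩ := toU a b v hab hv
  obtain ⟨k, hk, hkx, hky⟩ := toU x y v hxy hv
  have e1 : (k⁻¹ * g) a = x := by rw [Perm.mul_apply, hga, ← hkx, coe_inv, Equiv.symm_apply_apply]
  have e2 : (k⁻¹ * g) b = y := by rw [Perm.mul_apply, hgb, ← hky, coe_inv, Equiv.symm_apply_apply]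
  have hc : (k⁻¹ * g) c ∈ C := by
    refine hcov _ (fun h => ?_) (fun h => ?_)
    · exact hac ((k⁻¹ * g).injective (e1.trans h.symm))
    · exact hbc ((k⁻¹ * g).injective (e2.trans h.symm))
  obtain ⟨n, -, hn⟩ := hC.exists_pow_eq hc hz
  refine ⟨σ ^ n * (k⁻¹ * g), H.mul_mem (H.pow_mem hσ n) (H.mul_mem (H.inv_mem hk) hg), ?_, ?_, hn⟩
  · rw [Perm.mul_apply, e1]
    exact Perm.pow_apply_eq_self_of_apply_eq_self hx n
  · rw [Perm.mul_apply, e2]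
    exact Perm.pow_apply_eq_self_of_apply_eq_self hy n

/-- `H` contains a product of two disjoint transpositions. -/
def HasDoubleSwap (H : Subgroup (Perm α)) : Prop :=
  ∃ a b c d : α, a ≠ b ∧ a ≠ c ∧ b ≠ c ∧ a ≠ d ∧ b ≠ d ∧ c ≠ d ∧ swap a b * swap c d ∈ H

theorem HasDoubleSwap.exists_mem {H : Subgroup (Perm α)} (hd : HasDoubleSwap H) {x y z : α}
    (h : ∀ a b c : α, a ≠ b → a ≠ c → b ≠ c → ∃ h ∈ H, h a = x ∧ h b = y ∧ h c = z) :
    ∃ e, x ≠ e ∧ y ≠ e ∧ z ≠ e ∧ swap x y * swap z e ∈ H := by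
  obtain ⟨a, b, c, d, hab, hac, hbc, had, hbd, hcd, hm⟩ := hd
  obtain ⟨g, hg, rfl, rfl, rfl⟩ := h a b c hab hac hbc
  refine ⟨g d, g.injective.ne had, g.injective.ne hbd, g.injective.ne hcd, ?_⟩
  have := H.mul_mem (H.mul_mem hg hm) (H.inv_mem hg)
  rwa [show g * (swap a b * swap c d) * g⁻¹ = (g * swap a b * g⁻¹) * (g * swap c d * g⁻¹) by group,
    ← Equiv.swap_apply_apply, ← Equiv.swap_apply_apply] at this

/-- If `σ` is cyclic on four points and an appropriate even power of `σ` fixes all other points,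
then this power is a product of two disjoint transpositions. -/
theorem hasDoubleSwap_of_isCycleOn {H : Subgroup (Perm α)} {σ : Perm α} (hσ : σ ∈ H) {m : ℕ}
    {A : Finset α} (hA : σ.IsCycleOn A) (hcard : A.card = 4) (hm : m % 4 = 2)
    (hfix : ∀ x ∉ A, (σ ^ m) x = x) : HasDoubleSwap H := by
  obtain ⟨x, hx⟩ : A.Nonempty := by rw [← Finset.card_pos]; omega
  have key : ∀ i j : ℕ, (σ ^ i) x = (σ ^ j) x ↔ i % 4 = j % 4 := fun i j => by
    rw [hA.pow_apply_eq_pow_apply hx, hcard, Nat.ModEq]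
  have hpow : ∀ i j : ℕ, (σ ^ i) ((σ ^ j) x) = (σ ^ (i + j)) x := fun i j => by
    rw [pow_add, Perm.mul_apply]
  have hn : ∀ i j : ℕ, i % 4 ≠ j % 4 → (σ ^ i) x ≠ (σ ^ j) x := fun i j h => by
    rwa [Ne, key]
  -- On the 4-cycle σ^m acts as σ², which exchanges opposite points.
  refine ⟨(σ ^ 0) x, (σ ^ 2) x, (σ ^ 1) x, (σ ^ 3) x, ?_, ?_, ?_, ?_, ?_, ?_, ?_⟩
  iterate 6 · exact hn _ _ (by decide)
  convert H.pow_mem hσ m using 1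
  ext w
  by_cases hw : w ∈ A
  · obtain ⟨i, hi, rfl⟩ := hA.exists_pow_eq hx hw
    rw [hcard] at hi
    rw [hpow, Perm.mul_apply]
    interval_cases i
    · rw [swap_apply_of_ne_of_ne (hn 0 1 (by decide)) (hn 0 3 (by decide)),
        swap_apply_left, key]; omega
    · rw [swap_apply_left, swap_apply_of_ne_of_ne (hn 3 0 (by decide))
        (hn 3 2 (by decide)), key]; omega
    · rw [swap_apply_of_ne_of_ne (hn 2 1 (by decide)) (hn 2 3 (by decide)),
        swap_apply_right, key]; omega
    · rw [swap_apply_right, swap_apply_of_ne_of_ne (hn 1 0 (by decide))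
        (hn 1 2 (by decide)), key]; omega
  · have hmem : ∀ i : ℕ, (σ ^ i) x ∈ A := fun i => (hA.1.perm_pow i).mapsTo hx
    have hne : ∀ i : ℕ, w ≠ (σ ^ i) x := fun i h => hw (h ▸ hmem i)
    rw [hfix w hw, Perm.mul_apply, swap_apply_of_ne_of_ne (hne _) (hne _),
      swap_apply_of_ne_of_ne (hne _) (hne _)]

end ThreeTransitive

/-! ### Explicit words in degrees 8 and 10. -/

section SmallDegree

theorem HasType.hasDoubleSwap {α : Type*} [Fintype α] [DecidableEq α] {H : Subgroup (Perm α)}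
    {b c : ℕ} (h : HasType H 4 b c) (m : ℕ) (hm : m % 4 = 2) (hb : b = 0 ∨ b ∣ m) (hc : c = 0 ∨ c ∣ m) :
    HasDoubleSwap H := by
  obtain ⟨σ, hσ, A, B, C, hA, rfl, rfl, hT⟩ := h
  refine hasDoubleSwap_of_isCycleOn hσ hT.cycA hA hm fun x hx => ?_
  rcases hT.cover x with h | h | h
  · exact absurd h hx
  · exact (hT.cycB.pow_apply_eq h).2 (hb.resolve_left (Finset.card_ne_zero_of_mem h))
  · exact (hT.cycC.pow_apply_eq h).2 (hc.resolve_left (Finset.card_ne_zero_of_mem h))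

/-- Triple transitivity conjugates the double transposition to (6 7)(0 e). Multiplied by a power of
the 6-cycle it gives a permutation with one 2-cycle or 3-cycle that a suitable power isolates; for e
= 1 the word is a 5-cycle times (6 7). -/
theorem exists_card_support_of_degree_eight {H : Subgroup (Perm (Fin 8))} (h0 : HasType H 0 0 8)
    (h1 : HasType H 0 1 7) (hσ : List.formPerm [0, 1, 2, 3, 4, 5] ∈ H) (hd : HasDoubleSwap H) :
    ∃ τ ∈ H, τ.support.card = 2 ∨ τ.support.card = 3 := by
  have hcyc : (List.formPerm [0, 1, 2, 3, 4, 5] : Perm (Fin 8)).IsCycleOn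
      ({0, 1, 2, 3, 4, 5} : Finset (Fin 8)) := by
    convert List.Nodup.isCycleOn_formPerm (l := ([0, 1, 2, 3, 4, 5] : List (Fin 8))) (by decide)
    ext x; simp
  obtain ⟨e, he1, he2, he3, he⟩ := hd.exists_mem (x := 6) (y := 7) (z := 0)
    fun a b c hab hac hbc => exists_mem_map_triple h0.isPretransitive h1 hσ (by decide) (by decide)
      (by decide) hcyc (by decide) hab hac hbc (by decide)
  have hm : ∀ i j : ℕ, (List.formPerm [0, 1, 2, 3, 4, 5] ^ i * (swap 6 7 * swap 0 e)) ^ j ∈ H :=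
    fun i j => H.pow_mem (H.mul_mem (H.pow_mem hσ i) he) j
  fin_cases e
  · exact absurd rfl he3
  · exact ⟨_, hm 1 5, by decide +kernel⟩
  · exact ⟨_, hm 2 2, by decide +kernel⟩
  · exact ⟨_, hm 1 3, by decide +kernel⟩
  · exact ⟨_, hm 2 2, by decide +kernel⟩
  · exact ⟨_, hm 1 5, by decide +kernel⟩
  · exact absurd rfl he1
  · exact absurd rfl he2

theorem exists_card_support_of_degree_ten {H : Subgroup (Perm (Fin 10))} (h0 : HasType H 0 0 10)
    (h1 : HasType H 0 1 9) (hσ : List.formPerm [0, 1, 2, 3, 4, 5, 6, 7] ∈ H)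
    (hd : HasDoubleSwap H) : ∃ τ ∈ H, τ.support.card = 2 ∨ τ.support.card = 3 := by
  have hcyc : (List.formPerm [0, 1, 2, 3, 4, 5, 6, 7] : Perm (Fin 10)).IsCycleOn
      ({0, 1, 2, 3, 4, 5, 6, 7} : Finset (Fin 10)) := by
    convert List.Nodup.isCycleOn_formPerm (l := ([0, 1, 2, 3, 4, 5, 6, 7] : List (Fin 10)))
      (by decide)
    ext x; simp
  have htrans : ∀ {z : Fin 10}, z ∈ ({0, 1, 2, 3, 4, 5, 6, 7} : Finset (Fin 10)) →
      ∀ a b c : Fin 10, a ≠ b → a ≠ c → b ≠ c → ∃ h ∈ H, h a = 8 ∧ h b = 9 ∧ h c = z :=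
    fun hz a b c hab hac hbc => exists_mem_map_triple h0.isPretransitive h1 hσ (by decide)
      (by decide) (by decide) hcyc (by decide) hab hac hbc hz
  obtain ⟨e, he1, he2, he3, he⟩ := hd.exists_mem (htrans (z := 0) (by decide))
  have hm : ∀ i j : ℕ,
      (List.formPerm [0, 1, 2, 3, 4, 5, 6, 7] ^ i * (swap 8 9 * swap 0 e)) ^ j ∈ H :=
    fun i j => H.pow_mem (H.mul_mem (H.pow_mem hσ i) he) j
  -- Opposite points 0 and 4 are left aside: this case will use a second double transposition, (8
  -- 0)(1 e).
  have h4 : e = 4 ∨ ∃ τ ∈ H, τ.support.card = 2 ∨ τ.support.card = 3 := by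
    fin_cases e
    · exact absurd rfl he3
    · exact Or.inr ⟨_, hm 1 7, by decide +kernel⟩
    · exact Or.inr ⟨_, hm 2 4, by decide +kernel⟩
    · exact Or.inr ⟨_, hm 1 10, by decide +kernel⟩
    · exact Or.inl rfl
    · exact Or.inr ⟨_, hm 1 10, by decide +kernel⟩
    · exact Or.inr ⟨_, hm 2 4, by decide +kernel⟩
    · exact Or.inr ⟨_, hm 1 7, by decide +kernel⟩
    · exact absurd rfl he1
    · exact absurd rfl he2
  rcases h4 with rfl | h4
  swap
  · exact h4
  clear he1 he2 he3 hm
  obtain ⟨e, he1, he2, he3, hu⟩ := hd.exists_mem (x := 8) (y := 0) (z := 1)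
    fun a b c hab hac hbc => by
      obtain ⟨k, hk, hk1, hk2, hk3⟩ := htrans (z := 0) (by decide) a b c hab hac hbc
      -- `htrans` only reaches targets of the form (8, 9, z), so (8, 0, 1) is reached through (8, 9,
      -- 0).
      obtain ⟨l, hl, hl1, hl2, hl3⟩ := htrans (z := 0) (by decide) 8 0 1 (by decide) (by decide)
        (by decide)
      refine ⟨l⁻¹ * k, H.mul_mem (H.inv_mem hl) hk, ?_, ?_, ?_⟩ <;>
        rw [Perm.mul_apply, Perm.inv_eq_iff_eq]
      · rw [hk1, hl1]
      · rw [hk2, hl2]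
      · rw [hk3, hl3]
  have hm : ∀ i j : ℕ,
      (List.formPerm [0, 1, 2, 3, 4, 5, 6, 7] ^ i * (swap 8 0 * swap 1 e)) ^ j ∈ H :=
    fun i j => H.pow_mem (H.mul_mem (H.pow_mem hσ i) hu) j
  fin_cases e
  · exact absurd rfl he2
  · exact absurd rfl he3
  · exact ⟨_, hm 4 4, by decide +kernel⟩
  · exact ⟨_, hm 1 7, by decide +kernel⟩
  · exact ⟨_, H.pow_mem (H.mul_mem (hm 2 1) (hm 1 1)) 4, by decide +kernel⟩
  · exact ⟨_, hm 4 2, by decide +kernel⟩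
  · exact ⟨_, hm 4 4, by decide +kernel⟩
  · exact ⟨_, hm 2 5, by decide +kernel⟩
  · exact absurd rfl he1
  · exact ⟨_, H.pow_mem (H.mul_mem (hm 1 2) he) 4, by decide +kernel⟩

end SmallDegree

/-! ### Degrees 8 and 10 for a covering pair. -/

section SpecialDegrees

variable {α : Type*} [Fintype α] [DecidableEq α]

theorem alternatingGroup_le_of_card_support {H : Subgroup (Perm α)} (hH : IsPreprimitive H α)
    {τ : Perm α} (hτ : τ ∈ H) (h : τ.support.card = 2 ∨ τ.support.card = 3) :
    alternatingGroup α ≤ H := by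
  rcases h with h | h
  · rw [subgroup_eq_top_of_isPreprimitive_of_isSwap_mem hH τ (card_support_eq_two.1 h) hτ]
    exact le_top
  · exact alternatingGroup_le_of_isPreprimitive_of_isThreeCycle_mem hH
      (card_support_eq_three_iff.1 h) hτ

theorem HasType.comap_conj {H : Subgroup (Perm α)} {a b c : ℕ} (h : HasType H a b c)
    (g : Perm α) : HasType (H.comap (MulAut.conj g).toMonoidHom) a b c := by
  obtain ⟨σ, hσ, A, B, C, rfl, rfl, rfl, hT⟩ := h
  refine .of_conj_mem (g := g⁻¹) hT ?_
  rw [Subgroup.mem_comap]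
  simpa [mul_assoc] using hσ

theorem alternatingGroup_le_of_comap {H : Subgroup (Perm α)} (hH : IsPreprimitive H α)
    {g : Perm α} (h : ∃ τ ∈ H.comap (MulAut.conj g).toMonoidHom,
      τ.support.card = 2 ∨ τ.support.card = 3) : alternatingGroup α ≤ H := by
  obtain ⟨τ, hτ, hcard⟩ := h
  refine alternatingGroup_le_of_card_support hH (τ := g * τ * g⁻¹) (by simpa using hτ) ?_
  rwa [card_support_conj]

/-- The words need one specific 6-cycle. The covering puts a conjugate of it in `H`, so they are
applied to a conjugate of `H`; the square of type (4, 2, 2) is the double transposition. -/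
theorem alternatingGroup_le_of_degree_eight {H K : Subgroup (Perm (Fin 8))}
    (hc : ConjCovers H K) (hH : IsPreprimitive H (Fin 8)) (h0 : HasType H 0 0 8)
    (h1 : HasType H 0 1 7) (hK1 : ¬ HasType K 1 1 6) (h4 : HasType H 4 2 2) :
    alternatingGroup (Fin 8) ≤ H := by
  have hT : IsCycleTriple (List.formPerm [0, 1, 2, 3, 4, 5] : Perm (Fin 8)) {6} {7}
      {0, 1, 2, 3, 4, 5} := by
    refine ⟨by decide, by decide, by decide, by decide, ?_, ?_, ?_⟩
    · rw [Finset.coe_singleton, isCycleOn_singleton]; decide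
    · rw [Finset.coe_singleton, isCycleOn_singleton]; decide
    · convert List.Nodup.isCycleOn_formPerm (l := ([0, 1, 2, 3, 4, 5] : List (Fin 8))) (by decide)
      ext x; simp
  obtain ⟨g, hg | hg⟩ := hc (List.formPerm [0, 1, 2, 3, 4, 5])
  · exact alternatingGroup_le_of_comap hH <| exists_card_support_of_degree_eight (h0.comap_conj g)
      (h1.comap_conj g) (by simpa using hg) ((h4.comap_conj g).hasDoubleSwap 2 rfl (by decide)
        (by decide))
  · exact absurd (HasType.of_conj_mem hT hg) hK1

theorem alternatingGroup_le_of_degree_ten {H K : Subgroup (Perm (Fin 10))}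
    (hc : ConjCovers H K) (hH : IsPreprimitive H (Fin 10)) (h0 : HasType H 0 0 10)
    (h1 : HasType H 0 1 9) (hK1 : ¬ HasType K 1 1 8) (h4 : HasType H 4 0 6) :
    alternatingGroup (Fin 10) ≤ H := by
  have hT : IsCycleTriple (List.formPerm [0, 1, 2, 3, 4, 5, 6, 7] : Perm (Fin 10)) {8} {9}
      {0, 1, 2, 3, 4, 5, 6, 7} := by
    refine ⟨by decide, by decide, by decide, by decide, ?_, ?_, ?_⟩
    · rw [Finset.coe_singleton, isCycleOn_singleton]; decide
    · rw [Finset.coe_singleton, isCycleOn_singleton]; decide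
    · convert List.Nodup.isCycleOn_formPerm (l := ([0, 1, 2, 3, 4, 5, 6, 7] : List (Fin 10)))
        (by decide)
      ext x; simp
  obtain ⟨g, hg | hg⟩ := hc (List.formPerm [0, 1, 2, 3, 4, 5, 6, 7])
  · exact alternatingGroup_le_of_comap hH <| exists_card_support_of_degree_ten (h0.comap_conj g)
      (h1.comap_conj g) (by simpa using hg) ((h4.comap_conj g).hasDoubleSwap 6 rfl (by decide)
        (by decide))
  · exact absurd (HasType.of_conj_mem hT hg) hK1

end SpecialDegrees

/-! ### No covering pair in degree at least 7. -/

section LargeDegree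

variable {α : Type*} [Fintype α] [DecidableEq α]

theorem le_alternatingGroup_of_ne_top {H : Subgroup (Perm α)} (h : alternatingGroup α ≤ H)
    (hH : H ≠ ⊤) : H ≤ alternatingGroup α := by
  intro x hx
  by_contra hodd
  refine hH (eq_top_iff.2 fun g _ => ?_)
  have hx1 : sign x = -1 := (Int.units_eq_one_or _).resolve_left fun h => hodd h
  rcases Int.units_eq_one_or (sign g) with hg | hg
  · exact h hg
  · have : g * x⁻¹ ∈ H := h (by rw [mem_alternatingGroup, Perm.sign_mul, sign_inv, hg, hx1]; rfl)
    simpa using H.mul_mem this hx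

/-- A block through the fixed point has size 1 or is everything. -/
theorem HasType.isPreprimitive_of_fixed {H : Subgroup (Perm α)} (ht : IsPretransitive H α)
    {m : ℕ} (h : HasType H 1 0 m) : IsPreprimitive H α := by
  by_contra hp
  obtain ⟨d, hd, hd', -, h1, -⟩ := exists_block_card_of_not_isPreprimitive ht hp
  obtain ⟨y, z, hy, hz, he⟩ := h1 _ _ h
  have := h.add_eq
  omega

theorem HasType.isPreprimitive_of_coprime {H : Subgroup (Perm α)} (ht : IsPretransitive H α)
    {k m : ℕ} (h : HasType H 0 k m) (hk : 1 < k) (hm : 1 < m) (hco : k.Coprime m) :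
    IsPreprimitive H α := by
  by_contra hp
  obtain ⟨d, -, -, -, -, h1⟩ := exists_block_card_of_not_isPreprimitive ht hp
  exact h1 k m h hk hm hco

theorem HasType.swap {H : Subgroup (Perm α)} {a b c : ℕ} (h : HasType H a b c) :
    HasType H b a c := by
  obtain ⟨σ, hσ, A, B, C, ha, hb, hc, hT⟩ := h
  exact ⟨σ, hσ, B, A, C, hb, ha, hc, hT.disjAB.symm, hT.disjBC, hT.disjAC,
    fun x => by have := hT.cover x; tauto, hT.cycB, hT.cycA, hT.cycC⟩

/-- `H` would be A_n, so `K` has all odd types. For n even, (n), (1, 1, n-2) and (1, 2, n-3) make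
`K` primitive; for n odd, (1, n-1) and (2, n-2) do. The type with a 2-cycle and odd other lengths
then powers to a transposition. -/
theorem ConjCovers.not_alternatingGroup_le {H K : Subgroup (Perm α)} (hc : ConjCovers H K)
    (hn : 7 ≤ Fintype.card α) (hH : H ≠ ⊤) (hK : K ≠ ⊤) : ¬ alternatingGroup α ≤ H := by
  intro hle
  have hα : Nonempty α := Fintype.card_pos_iff.1 (by omega)
  have hle' := le_alternatingGroup_of_ne_top hle hH
  set n := Fintype.card α with hndef
  rcases Nat.even_or_odd' n with ⟨m, hm | hm⟩
  · have t0 : HasType K 0 0 n :=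
      hc.hasType_of_le_alternating hle' (by omega) ⟨m - 1, by omega⟩
    have t1 : HasType K 1 1 (n - 2) :=
      hc.hasType_of_le_alternating hle' (by omega) ⟨m - 2, by omega⟩
    have t2 : HasType K 1 2 (n - 3) :=
      hc.hasType_of_le_alternating hle' (by omega) ⟨m - 2, by omega⟩
    refine hK (t2.swap.eq_top ?_ (by omega) (by omega))
    by_contra hp
    obtain ⟨d, hd, hd', hdvd, h1, -⟩ := exists_block_card_of_not_isPreprimitive t0.isPretransitive hp
    obtain ⟨y, z, hy, hz, he⟩ := h1 _ _ t1
    obtain ⟨y', z', hy', hz', he'⟩ := h1 _ _ t2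
    obtain ⟨q, hq⟩ := hdvd
    have : 2 ≤ q := by
      by_contra hq2
      interval_cases q <;> omega
    have : d * 2 ≤ n := by rw [hndef, hq]; exact Nat.mul_le_mul_left d this
    omega
  · have t1 : HasType K 0 1 (n - 1) :=
      hc.hasType_of_le_alternating hle' (by omega) ⟨m - 1, by omega⟩
    have t2 : HasType K 0 2 (n - 2) :=
      hc.hasType_of_le_alternating hle' (by omega) ⟨m - 1, by omega⟩
    have ht : IsPretransitive K α := by
      by_contra ht
      obtain ⟨s, hs, hs', hsum⟩ := exists_partial_sum_of_not_isPretransitive ht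
      obtain ⟨x, y, z, hx, hy, hz, he⟩ := hsum _ _ _ t1
      obtain ⟨x', y', z', hx', hy', hz', he'⟩ := hsum _ _ _ t2
      omega
    have hp : IsPreprimitive K α := t1.swap.isPreprimitive_of_fixed ht
    exact hK (t2.swap.eq_top hp (by omega) (by omega))

/-- Two odd numbers symmetric about n/2, differing by 2 or by 4, are coprime. -/
theorem exists_coprime_add {n : ℕ} (hn : 7 ≤ n) (h2 : 2 ∣ n) :
    ∃ k, 1 < k ∧ 1 < n - k ∧ k.Coprime (n - k) := by
  obtain ⟨m, rfl⟩ := h2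
  rcases Nat.even_or_odd m with hm | hm
  · refine ⟨m - 1, by omega, by omega, ?_⟩
    rw [show 2 * m - (m - 1) = (m - 1) + 2 by omega, Nat.coprime_self_add_right,
      Nat.coprime_two_right]
    exact Nat.Even.sub_odd (by omega) hm odd_one
  · refine ⟨m - 2, by omega, by omega, ?_⟩
    rw [show 2 * m - (m - 2) = (m - 2) + 2 ^ 2 by omega, Nat.coprime_self_add_right]
    refine Nat.Coprime.pow_right 2 (Nat.coprime_two_right.2 ?_)
    exact Nat.Odd.sub_even (by omega) hm even_two

/-- Type (2, n-2) is coprime and powers to a transposition, so it forces `K` to be intransitive,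
with a fixed set of size 2 or n-2. That pushes (1, n-1) and a type powering to a 3-cycle into `H`.
-/
theorem ConjCovers.false_of_odd {H K : Subgroup (Perm α)} (hc : ConjCovers H K)
    (hn : 7 ≤ Fintype.card α) (hodd : ¬ 2 ∣ Fintype.card α)
    (hH : ¬ alternatingGroup α ≤ H) (hK : ¬ alternatingGroup α ≤ K)
    (t0 : HasType H 0 0 (Fintype.card α)) : False := by
  have hα : Nonempty α := Fintype.card_pos_iff.1 (by omega)
  set n := Fintype.card α with hndef
  have hcop : Nat.Coprime 2 (n - 2) := by
    rw [Nat.coprime_two_left, ← Nat.not_even_iff_odd, even_iff_two_dvd]; omega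
  have main : ∀ L : Subgroup (Perm α), ¬ alternatingGroup α ≤ L → HasType L 0 2 (n - 2) →
      ¬ IsPretransitive L α := fun L hL t ht =>
    hL (t.swap.eq_top (t.isPreprimitive_of_coprime ht (by omega) (by omega) hcop)
      (by omega) (by omega) ▸ le_top)
  have t2 : HasType K 0 2 (n - 2) := (hc.hasType (by omega)).resolve_left fun t =>
    main H hH t t0.isPretransitive
  obtain ⟨s, hs, hs', hsum⟩ := exists_partial_sum_of_not_isPretransitive (main K hK t2)
  obtain ⟨x, y, z, hx, hy, hz, he⟩ := hsum _ _ _ t2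
  have t1 : HasType H 1 0 (n - 1) := (hc.hasType (by omega)).resolve_right fun t => by
    obtain ⟨x, y, z, hx, hy, hz, he⟩ := hsum _ _ _ t
    omega
  have hp := t1.isPreprimitive_of_fixed t0.isPretransitive
  by_cases h3 : 3 ∣ n
  · have t3 : HasType H 3 1 (n - 4) := (hc.hasType (by omega)).resolve_right fun t => by
      obtain ⟨x, y, z, hx, hy, hz, he⟩ := hsum _ _ _ t
      omega
    exact hH (t3.alternatingGroup_le hp (by omega) (by omega))
  · have t3 : HasType H 3 0 (n - 3) := (hc.hasType (by omega)).resolve_right fun t => by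
      obtain ⟨x, y, z, hx, hy, hz, he⟩ := hsum _ _ _ t
      omega
    exact hH (t3.alternatingGroup_le hp (by omega) (by omega))

theorem coprime_three_sub {n : ℕ} (hn : 3 ≤ n) (h3 : ¬ 3 ∣ n) : Nat.Coprime 3 (n - 3) :=
  (Nat.Prime.coprime_iff_not_dvd Nat.prime_three).2 (by omega)

/-- A transitive group with both cycle types `(1, 2, n - 3)` and `(1, 3, n - 4)` is primitive. -/
theorem HasType.isPreprimitive_of_one_two_of_one_three {H : Subgroup (Perm α)}
    (ht : IsPretransitive H α) (hn : 8 ≤ Fintype.card α)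
    (t1 : HasType H 1 2 (Fintype.card α - 3)) (t2 : HasType H 1 3 (Fintype.card α - 4)) :
    IsPreprimitive H α := by
  by_contra hp
  obtain ⟨d, hd, hd', -, h1, -⟩ := exists_block_card_of_not_isPreprimitive ht hp
  obtain ⟨y, z, hy, hz, he⟩ := h1 _ _ t1
  obtain ⟨y', z', hy', hz', he'⟩ := h1 _ _ t2
  omega

theorem ConjCovers.false_of_even {n : ℕ} {H K : Subgroup (Perm (Fin n))} (hc : ConjCovers H K)
    (hn : 7 ≤ n) (heven : 2 ∣ n) (hH : ¬ alternatingGroup (Fin n) ≤ H)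
    (hK : ¬ alternatingGroup (Fin n) ≤ K) (t0 : HasType H 0 0 n) : False := by
  have hα : Nonempty (Fin n) := ⟨⟨0, by omega⟩⟩
  have hcard : Fintype.card (Fin n) = n := Fintype.card_fin n
  have ht := t0.isPretransitive
  -- a group not containing the alternating group avoids some cycle types
  have avoid2 : ∀ L : Subgroup (Perm (Fin n)), ¬ alternatingGroup (Fin n) ≤ L →
      IsPreprimitive L (Fin n) → ∀ b c, ¬ 2 ∣ b → ¬ 2 ∣ c → ¬ HasType L 2 b c :=
    fun L hL hp b c hb hc t => hL (t.eq_top hp (Or.inr hb) (Or.inr hc) ▸ le_top)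
  have avoid3 : ∀ L : Subgroup (Perm (Fin n)), ¬ alternatingGroup (Fin n) ≤ L →
      IsPreprimitive L (Fin n) → ¬ 3 ∣ n → ¬ HasType L 3 0 (n - 3) :=
    fun L hL hp h3 t => hL (t.alternatingGroup_le hp (by omega) (by omega))
  have avoid31 : ∀ L : Subgroup (Perm (Fin n)), ¬ alternatingGroup (Fin n) ≤ L →
      IsPreprimitive L (Fin n) → 3 ∣ n → ¬ HasType L 3 1 (n - 4) :=
    fun L hL hp h3 t => hL (t.alternatingGroup_le hp (by omega) (by omega))
  have avoid_trans : ∀ L : Subgroup (Perm (Fin n)), ¬ alternatingGroup (Fin n) ≤ L →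
      IsPretransitive L (Fin n) → ¬ 3 ∣ n → ¬ HasType L 3 0 (n - 3) :=
    fun L hL ht h3 t => avoid3 L hL (t.swap.isPreprimitive_of_coprime ht (by omega) (by omega)
      (coprime_three_sub (by omega) h3)) h3 t
  have avoid_trans' : ∀ L : Subgroup (Perm (Fin n)), ¬ alternatingGroup (Fin n) ≤ L →
      IsPretransitive L (Fin n) → 3 ∣ n → HasType L 2 1 (n - 3) → ¬ HasType L 3 1 (n - 4) :=
    fun L hL ht h3 t t' => avoid31 L hL (HasType.isPreprimitive_of_one_two_of_one_three ht
      (by omega) (by rw [hcard]; exact t.swap) (by rw [hcard]; exact t'.swap)) h3 t'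
  rcases hc.hasType (a := 1) (b := 0) (c := n - 1) (by omega) with t1 | t1
  -- `H` is primitive, so all types (2, b, c) with b, c odd go to `K`.
  · have hp := t1.isPreprimitive_of_fixed ht
    have k2 : ∀ b c, 2 + b + c = n → ¬ 2 ∣ b → ¬ 2 ∣ c → HasType K 2 b c :=
      fun b c h hb hc' => (hc.hasType (by omega)).resolve_left (avoid2 H hH hp b c hb hc')
    have s1 := k2 1 (n - 3) (by omega) (by omega) (by omega)
    by_cases h3 : 3 ∣ n
    · have s2 := k2 5 (n - 7) (by omega) (by omega) (by omega)
      have s3 : HasType K 3 1 (n - 4) :=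
        (hc.hasType (by omega)).resolve_left (avoid31 H hH hp h3)
      have hKt : IsPretransitive K (Fin n) := by
        by_contra hKt
        obtain ⟨s, hs, hs', hsum⟩ := exists_partial_sum_of_not_isPretransitive hKt
        obtain ⟨x, y, z, hx, hy, hz, he⟩ := hsum _ _ _ s1
        obtain ⟨x', y', z', hx', hy', hz', he'⟩ := hsum _ _ _ s2
        obtain ⟨x'', y'', z'', hx'', hy'', hz'', he''⟩ := hsum _ _ _ s3
        omega
      exact avoid_trans' K hK hKt h3 s1 s3
    · have s3 : HasType K 3 0 (n - 3) :=
        (hc.hasType (by omega)).resolve_left (avoid3 H hH hp h3)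
      have hKt : ¬ IsPretransitive K (Fin n) := fun hKt => avoid_trans K hK hKt h3 s3
      obtain ⟨s, hs, hs', hsum⟩ := exists_partial_sum_of_not_isPretransitive hKt
      obtain ⟨x, y, z, hx, hy, hz, he⟩ := hsum _ _ _ s3
      -- `K` fixes a set of size 3 or n-3, which is a partial sum of (2, 5, n-7) only in these
      -- degrees.
      have hn' : n = 8 ∨ n = 10 := by
        by_contra hcon
        have s2 := k2 5 (n - 7) (by omega) (by omega) (by omega)
        obtain ⟨x', y', z', hx', hy', hz', he'⟩ := hsum _ _ _ s2
        omega
      have out : ∀ a b c, (∀ x y z, (x = a ∨ x = 0) → (y = b ∨ y = 0) →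
          (z = c ∨ z = 0) → s ≠ x + y + z) → ¬ HasType K a b c := by
        intro a b c hne t
        obtain ⟨x, y, z, hx, hy, hz, he⟩ := hsum _ _ _ t
        exact hne x y z hx hy hz he
      rcases hn' with rfl | rfl
      · exact hH (alternatingGroup_le_of_degree_eight hc hp t0 t1.swap
          (out 1 1 6 (by omega))
          ((hc.hasType (by simp)).resolve_right (out 4 2 2 (by omega))))
      · exact hH (alternatingGroup_le_of_degree_ten hc hp t0 t1.swap
          (out 1 1 8 (by omega))
          ((hc.hasType (by simp)).resolve_right (out 4 0 6 (by omega))))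
  · by_cases hKt : IsPretransitive K (Fin n)
    · have hp := t1.isPreprimitive_of_fixed hKt
      by_cases h3 : 3 ∣ n
      · exact avoid_trans' H hH ht h3
          ((hc.hasType (by omega)).resolve_right (avoid2 K hK hp _ _ (by omega) (by omega)))
          ((hc.hasType (by omega)).resolve_right (avoid31 K hK hp h3))
      · exact avoid_trans H hH ht h3
          ((hc.hasType (by omega)).resolve_right (avoid3 K hK hp h3))
    · obtain ⟨s, hs, hs', hsum⟩ := exists_partial_sum_of_not_isPretransitive hKt
      obtain ⟨x, y, z, hx, hy, hz, he⟩ := hsum _ _ _ t1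
      -- `K` fixes a set of size 1 or n-1, so types without cycles of length 1 or n-1 and with no
      -- such partial sum must lie in `H`.
      obtain ⟨k, hk, hk', hco⟩ := exists_coprime_add hn heven
      have t2 : HasType H 0 k (n - k) := (hc.hasType (by omega)).resolve_right fun t => by
        obtain ⟨x, y, z, hx, hy, hz, he⟩ := hsum _ _ _ t
        omega
      have t3 : HasType H 2 3 (n - 5) := (hc.hasType (by omega)).resolve_right fun t => by
        obtain ⟨x, y, z, hx, hy, hz, he⟩ := hsum _ _ _ t
        omega
      exact avoid2 H hH (t2.isPreprimitive_of_coprime ht hk hk' hco) 3 (n - 5) (by omega)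
        (by omega) t3

theorem not_conjCovers {n : ℕ} (hn : 7 ≤ n) {H K : Subgroup (Perm (Fin n))} (hH : H ≠ ⊤)
    (hK : K ≠ ⊤) : ¬ ConjCovers H K := by
  intro hc
  have hcard : Fintype.card (Fin n) = n := Fintype.card_fin n
  have aH := hc.not_alternatingGroup_le (by omega) hH hK
  have aK := hc.symm.not_alternatingGroup_le (by omega) hK hH
  by_cases h2 : 2 ∣ n
  · rcases hc.hasType (a := 0) (b := 0) (c := n) (by omega) with t | t
    · exact hc.false_of_even hn h2 aH aK t
    · exact hc.symm.false_of_even hn h2 aK aH t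
  · rcases hc.hasType (a := 0) (b := 0) (c := Fintype.card (Fin n)) (by omega) with t | t
    · exact hc.false_of_odd (by omega) (by omega) aH aK t
    · exact hc.symm.false_of_odd (by omega) (by omega) aK aH t

end LargeDegree

/-! ### From conjugate covers to coverings, and the degrees up to 6. -/

section Coverings

variable {G : Type*} [Group G]

theorem mem_conjSubgroup {H : Subgroup G} {g x : G} : x ∈ conjSubgroup H g ↔ g * x * g⁻¹ ∈ H := by
  rw [conjSubgroup, Subgroup.mem_map_equiv, MulAut.conj_symm_apply, inv_inv]

theorem IsCovering.conjCovers {H K : Subgroup G} (h : IsCovering (conjFamily H K)) :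
    ConjCovers H K := by
  intro σ
  have := h.union_eq.ge (Set.mem_univ σ)
  simp only [Set.mem_iUnion, conjFamily, Set.mem_ofPred_eq] at this
  obtain ⟨L, ⟨g, rfl | rfl⟩, hL⟩ := this
  · exact ⟨g, Or.inl (mem_conjSubgroup.1 hL)⟩
  · exact ⟨g, Or.inr (mem_conjSubgroup.1 hL)⟩

theorem conjSubgroup_lt_top {H : Subgroup G} (hH : H < ⊤) (g : G) : conjSubgroup H g < ⊤ := by
  refine lt_top_iff_ne_top.2 fun h => hH.ne (eq_top_iff.2 fun x _ => ?_)
  have : g⁻¹ * x * g ∈ conjSubgroup H g := h ▸ Subgroup.mem_top _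
  simpa [mem_conjSubgroup, mul_assoc] using this

theorem conjSubgroup_eq_of_le [Finite G] {H : Subgroup G} {g k : G}
    (h : conjSubgroup H g ≤ conjSubgroup H k) : conjSubgroup H g = conjSubgroup H k := by
  refine Subgroup.eq_of_le_of_card_ge h (le_of_eq ?_)
  rw [conjSubgroup, conjSubgroup, Subgroup.card_map_of_injective (MulAut.conj _).injective,
    Subgroup.card_map_of_injective (MulAut.conj _).injective]

theorem not_conjSubgroup_le {H K : Subgroup G} {x : G} (hx : x ∈ H)
    (hK : ∀ g : G, g * x * g⁻¹ ∉ K) (g k : G) : ¬ conjSubgroup H g ≤ conjSubgroup K k := by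
  intro h
  have h1 : g⁻¹ * x * g ∈ conjSubgroup H g := by
    rw [mem_conjSubgroup]; simpa [mul_assoc] using hx
  have h2 := mem_conjSubgroup.1 (h h1)
  refine hK (k * g⁻¹) ?_
  simpa [mul_assoc] using h2

/-- The witnesses `x` and `y` rule out inclusions between conjugates of different subgroups;
conjugates of one subgroup have equal order. -/
theorem isStarStarCoverable_of_conjCovers [Finite G] {H K : Subgroup G} (hc : ConjCovers H K)
    {x y : G} (hx : x ∈ H) (hxK : ∀ g : G, g * x * g⁻¹ ∉ K) (hy : y ∈ K)
    (hyH : ∀ g : G, g * y * g⁻¹ ∉ H) : IsStarStarCoverable G := by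
  have hH : H < ⊤ := lt_top_iff_ne_top.2 fun h => hyH 1 (h ▸ Subgroup.mem_top _)
  have hK : K < ⊤ := lt_top_iff_ne_top.2 fun h => hxK 1 (h ▸ Subgroup.mem_top _)
  refine ⟨H, K, hH, hK, ⟨?_, ?_, ?_⟩⟩
  · rintro L ⟨g, rfl | rfl⟩
    exacts [conjSubgroup_lt_top hH g, conjSubgroup_lt_top hK g]
  · refine Set.eq_univ_of_forall fun σ => ?_
    obtain ⟨g, hg | hg⟩ := hc σ
    · exact Set.mem_biUnion (show conjSubgroup H g ∈ conjFamily H K from ⟨g, Or.inl rfl⟩)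
        (mem_conjSubgroup.2 hg)
    · exact Set.mem_biUnion (show conjSubgroup K g ∈ conjFamily H K from ⟨g, Or.inr rfl⟩)
        (mem_conjSubgroup.2 hg)
  · rintro L ⟨g, rfl | rfl⟩ M ⟨k, rfl | rfl⟩ hne hle
    · exact hne (conjSubgroup_eq_of_le hle)
    · exact not_conjSubgroup_le hx hxK g k hle
    · exact not_conjSubgroup_le hy hyH g k hle
    · exact hne (conjSubgroup_eq_of_le hle)

theorem isStarStarCoverable_perm_three : IsStarStarCoverable (Perm (Fin 3)) :=
  isStarStarCoverable_of_conjCovers (H := alternatingGroup (Fin 3))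
    (K := stabilizer (Perm (Fin 3)) (0 : Fin 3))
    (x := finRotate 3) (y := swap 1 2)
    (by unfold ConjCovers; simp only [mem_alternatingGroup, mem_stabilizer_iff, Perm.smul_def]
        decide +kernel)
    (by rw [mem_alternatingGroup]; decide +kernel)
    (by simp only [mem_stabilizer_iff, Perm.smul_def]; decide +kernel)
    (by simp only [mem_stabilizer_iff, Perm.smul_def]; decide +kernel)
    (by simp only [mem_alternatingGroup]; decide +kernel)

/-- The centralizer is dihedral of order 8 and meets every fixed-point-free class. -/
theorem isStarStarCoverable_perm_four : IsStarStarCoverable (Perm (Fin 4)) :=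
  isStarStarCoverable_of_conjCovers (H := Subgroup.centralizer {swap 0 2 * swap 1 3})
    (K := stabilizer (Perm (Fin 4)) (0 : Fin 4))
    (x := finRotate 4) (y := swap 1 2 * swap 2 3)
    (by unfold ConjCovers
        simp only [Subgroup.mem_centralizer_singleton_iff, mem_stabilizer_iff, Perm.smul_def]
        decide +kernel)
    (by rw [Subgroup.mem_centralizer_singleton_iff]; decide +kernel)
    (by simp only [mem_stabilizer_iff, Perm.smul_def]; decide +kernel)
    (by simp only [mem_stabilizer_iff, Perm.smul_def]; decide +kernel)
    (by simp only [Subgroup.mem_centralizer_singleton_iff]; decide +kernel)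

/-- Membership in the affine group of degree five, the normalizer of a cycle of length five. -/
theorem mem_normalizer_zpowers_finRotate {g : Perm (Fin 5)} :
    g ∈ Subgroup.normalizer (Subgroup.zpowers (finRotate 5) : Set (Perm (Fin 5))) ↔
      ∃ k : Fin 5, g * finRotate 5 = finRotate 5 ^ (k : ℕ) * g := by
  have h5 : finRotate 5 ^ 5 = 1 := by decide +kernel
  constructor
  · intro h
    have h1 := (Subgroup.mem_set_normalizer_iff.1 h _).1 (Subgroup.mem_zpowers (finRotate 5))
    obtain ⟨k, hk⟩ := mem_powers_iff_mem_zpowers.2 h1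
    refine ⟨⟨k % 5, Nat.mod_lt _ (by norm_num)⟩, ?_⟩
    rw [← mul_inv_eq_iff_eq_mul, ← hk]
    exact pow_eq_pow_mod k h5
  · rintro ⟨k, hk⟩
    rw [← mul_inv_eq_iff_eq_mul] at hk
    refine Subgroup.mem_normalizer_fintype ?_
    rintro _ ⟨m, rfl⟩
    exact ⟨k * m, by simp only [← conj_zpow, hk, zpow_mul, zpow_natCast]⟩

/-- Only 4-cycles and 5-cycles preserve no pair of points. The conjugators are the six permutations
of {2, 3, 4}, which represent the cosets of AGL(1,5), a sharply 2-transitive group. -/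
theorem exists_pair_or_conj_normalize : ∀ σ : Perm (Fin 5),
    (∃ i j : Fin 5, i ≠ j ∧ (σ i = i ∧ σ j = j ∨ σ i = j ∧ σ j = i)) ∨
    ∃ i ∈ [2, 3, 4], ∃ j ∈ [3, 4], ∃ k : Fin 5,
      (swap 2 i * swap 3 j) * σ * (swap 2 i * swap 3 j)⁻¹ * finRotate 5 =
        finRotate 5 ^ (k : ℕ) * ((swap 2 i * swap 3 j) * σ * (swap 2 i * swap 3 j)⁻¹) := by
  decide +kernel

theorem isStarStarCoverable_perm_five : IsStarStarCoverable (Perm (Fin 5)) :=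
  isStarStarCoverable_of_conjCovers
    (H := Subgroup.normalizer (Subgroup.zpowers (finRotate 5) : Set (Perm (Fin 5))))
    (K := Subgroup.centralizer {swap (0 : Fin 5) 1})
    (x := finRotate 5) (y := swap 0 1)
    (fun σ => by
      rcases exists_pair_or_conj_normalize σ with ⟨i, j, hij, h⟩ | ⟨i, -, j, -, h⟩
      · obtain ⟨g, hi, hj⟩ : ∃ g : Perm (Fin 5), g 0 = i ∧ g 1 = j :=
          ⟨swap 0 i * swap 1 (swap 0 i j), by clear h; revert i j; decide +kernel⟩
        refine ⟨g⁻¹, Or.inr (Subgroup.mem_centralizer_singleton_iff.2 ?_)⟩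
        rw [mul_swap_eq_swap_mul, inv_inv, Perm.mul_apply, Perm.mul_apply, Perm.mul_apply,
          Perm.mul_apply, hi, hj]
        rcases h with ⟨h1, h2⟩ | ⟨h1, h2⟩
        · rw [h1, h2, Perm.inv_eq_iff_eq.2 hi.symm, Perm.inv_eq_iff_eq.2 hj.symm]
        · rw [h1, h2, Perm.inv_eq_iff_eq.2 hi.symm, Perm.inv_eq_iff_eq.2 hj.symm, swap_comm]
      · exact ⟨_, Or.inl (mem_normalizer_zpowers_finRotate.2 h)⟩)
    (by rw [mem_normalizer_zpowers_finRotate]; decide +kernel)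
    (by simp only [Subgroup.mem_centralizer_singleton_iff]; decide +kernel)
    (by rw [Subgroup.mem_centralizer_singleton_iff])
    (by simp only [mem_normalizer_zpowers_finRotate]; decide +kernel)

/-- Every fixed-point-free σ commutes with one of the 15 fixed-point-free involutions, listed by i
and j. The normalization σ 0 = 1 shortens the check. -/
theorem exists_conj_commute_or_fixed : ∀ σ : Perm (Fin 6), σ 0 = 1 → (∃ i, σ i = i) ∨
    ∃ i ∈ [1, 2, 3, 4, 5], ∃ j ∈ [3, 4, 5], ∀ x,
      σ (swap 1 i (swap 3 j
        ((swap 0 1 * swap 2 3 * swap 4 5 : Perm (Fin 6)) (swap 3 j (swap 1 i x))))) =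
        swap 1 i (swap 3 j
          ((swap 0 1 * swap 2 3 * swap 4 5 : Perm (Fin 6)) (swap 3 j (swap 1 i (σ x))))) := by
  decide +kernel

theorem isStarStarCoverable_perm_six : IsStarStarCoverable (Perm (Fin 6)) := by
  refine isStarStarCoverable_of_conjCovers
    (H := Subgroup.centralizer {swap (0 : Fin 6) 1 * swap 2 3 * swap 4 5})
    (K := stabilizer (Perm (Fin 6)) (0 : Fin 6))
    (x := swap 0 1 * swap 2 3 * swap 4 5) (y := swap 1 2 * swap 2 3 * swap 3 4 * swap 4 5)
    (fun σ => ?_)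
    (by rw [Subgroup.mem_centralizer_singleton_iff])
    (by simp only [mem_stabilizer_iff, Perm.smul_def]; decide +kernel)
    (by simp only [mem_stabilizer_iff, Perm.smul_def]; decide +kernel)
    (by simp only [Subgroup.mem_centralizer_singleton_iff]; decide +kernel)
  by_cases hfix : ∃ i, σ i = i
  · obtain ⟨i, hi⟩ := hfix
    refine ⟨swap 0 i, Or.inr ?_⟩
    rw [mem_stabilizer_iff, Perm.smul_def, Perm.mul_apply, Perm.mul_apply, swap_inv,
      swap_apply_left, hi, swap_apply_right]
  push Not at hfix
  set k := swap 1 (σ 0) with hk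
  have hk0 : k 0 = 0 := swap_apply_of_ne_of_ne (by decide) (hfix 0).symm
  rcases exists_conj_commute_or_fixed (k * σ * k⁻¹) (by
    rw [Perm.mul_apply, Perm.mul_apply, Perm.inv_eq_iff_eq.2 hk0.symm, hk, swap_apply_right]) with
    ⟨i, hi⟩ | ⟨i, -, j, -, h⟩
  · refine absurd ?_ (hfix (k⁻¹ i))
    rw [Perm.eq_inv_iff_eq]
    exact hi
  · refine ⟨swap 3 j * swap 1 i * k, Or.inl (Subgroup.mem_centralizer_singleton_iff.2 ?_)⟩
    ext x : 1
    have := congrArg (swap 3 j ∘ swap 1 i) (h (swap 1 i (swap 3 j x)))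
    simpa [mul_assoc, Function.comp_def] using this

theorem three_le_of_isStarStarCoverable {n : ℕ} (h : IsStarStarCoverable (Perm (Fin n))) :
    3 ≤ n := by
  by_contra hn
  obtain ⟨H, K, hH, hK, hcov⟩ := h
  have hc := hcov.conjCovers
  have hbot : ∀ L : Subgroup (Perm (Fin n)), L < ⊤ → L = ⊥ := by
    intro L hL
    have h2 : Nat.card (Perm (Fin n)) ≤ 2 := by
      rw [Nat.card_eq_fintype_card, Fintype.card_perm, Fintype.card_fin]
      interval_cases n <;> decide
    refine L.eq_bot_of_card_le ?_
    obtain ⟨q, hq⟩ := L.card_subgroup_dvd_card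
    have hne : Nat.card L ≠ Nat.card (Perm (Fin n)) := fun h => hL.ne (L.card_eq_iff_eq_top.1 h)
    have hle := Subgroup.card_le_card_group L
    omega
  have h1 : ∀ σ : Perm (Fin n), σ = 1 := by
    intro σ
    obtain ⟨g, hg | hg⟩ := hc σ
    · rw [hbot H hH, Subgroup.mem_bot] at hg; simpa using hg
    · rw [hbot K hK, Subgroup.mem_bot] at hg; simpa using hg
  exact hH.ne (eq_top_iff.2 fun σ _ => h1 σ ▸ H.one_mem)

end Coverings

theorem theorem4p2 (n : ℕ) :
    IsStarStarCoverable (Equiv.Perm (Fin n)) ↔ 3 ≤ n ∧ n ≤ 6 := by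
  constructor
  · intro h
    refine ⟨three_le_of_isStarStarCoverable h, ?_⟩
    by_contra hn
    obtain ⟨H, K, hH, hK, hcov⟩ := h
    exact not_conjCovers (by omega) hH.ne hK.ne hcov.conjCovers
  · rintro ⟨h3, h6⟩
    interval_cases n
    exacts [isStarStarCoverable_perm_three, isStarStarCoverable_perm_four,
      isStarStarCoverable_perm_five, isStarStarCoverable_perm_six]
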